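/- Let $d\in\mathbb N$ and $m\ge 0$, and write $\langle x\rangle=(1+|x|^2)^{1/2}$. Let $A\in C^\infty(\mathbb R^d;\mathbb R^d)$, and suppose that for some $\tau\ge 0$ and every multi-index $\beta$ there is a constant $C_\beta$ with $$|\partial_x^\beta A(x)|\le C_\beta\langle x\rangle^{\tau}\qquad(x\in\mathbb R^d).$$ For $F:\mathbb R^d\times\mathbb R^d\to\mathbb C$, say that the oscillatory integral of $F$ exists and equals $I\in\mathbb C$, written $I=\text{Os-}\!\iint F(\xi,y)\,dy\,d\xi$, if for every $\chi\in\mathcal S(\mathbb R^d\times\mathbb R^d)$ with $\chi(0,0)=1$ the function $\chi(\varepsilon\xi,\varepsilon y)F(\xi,y)$ is integrable on $\mathbb R^d\times\mathbb R^d$ for every $\varepsilon>0$ and $$\lim_{\varepsilon\to0+}\iint_{\mathbb R^d\times\mathbb R^d}\chi(\varepsilon\xi,\varepsilon y)F(\xi,y)\,dy\,d\xi=I .$$ Then for every $f\in C_0^\infty(\mathbb R^d)$ and every $x\in\mathbb R^d$ the oscillatory integral defining the Weyl pseudo-differential operator $$(H_A^{(1)}f)(x):=\frac1{(2\pi)^d}\,\text{Os-}\!\iint_{\mathbb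 R^d\times\mathbb R^d}e^{i(x-y)\cdot\xi}\sqrt{\Big(\xi-A\big(\tfrac{x+y}2\big)\Big)^2+m^2}\;f(y)\,dy\,d\xi$$ exists, the oscillatory integral on the right-hand side below exists, and $$(H_A^{(1)}f)(x)=\frac1{(2\pi)^d}\,\text{Os-}\!\iint_{\mathbb R^d\times\mathbb R^d}e^{i(x-y)\cdot(\xi+A(\frac{x+y}2))}\sqrt{\xi^2+m^2}\;f(y)\,dy\,d\xi .$$ -/

import Mathlib

open MeasureTheory Filter Topology
open scoped ContDiff SchwartzMap

noncomputable section

namespace MagneticWeyl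

/-- The space `ℝ^d` with its Euclidean norm. -/
abbrev Space (d : ℕ) : Type := EuclideanSpace ℝ (Fin d)

/-- The mixed partial derivative `∂_{i 0} ⋯ ∂_{i (n-1)} A (x)` of order `n` of a smooth vector
field. Every `∂^β A` with `|β| = n` is of this form. -/
def partialDeriv {d n : ℕ} (i : Fin n → Fin d) (A : Space d → Space d) (x : Space d) : Space d :=
  iteratedFDeriv ℝ n A x (fun j => EuclideanSpace.single (i j) (1 : ℝ))

/-- The regularised integral `∫∫ χ(εξ, εy) F(ξ, y) dy dξ` has the integrand
`χ(εξ, εy) F(ξ, y)`; the point of `ℝ^d × ℝ^d` is written `p = (ξ, y)`. -/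
def regularized {d : ℕ} (χ : 𝓢(Space d × Space d, ℂ)) (F : Space d × Space d → ℂ) (ε : ℝ)
    (p : Space d × Space d) : ℂ :=
  χ (ε • p) * F p

/-- `I` is the oscillatory integral `Os-∫∫ F(ξ, y) dy dξ`: for every cutoff function `χ` in
`𝓢(ℝ^d × ℝ^d)` with `χ(0, 0) = 1`, the functions `χ(εξ, εy) F(ξ, y)`, `ε > 0`, are integrable, and
their integrals tend to `I` as `ε → 0+`. -/
def HasOscIntegral {d : ℕ} (F : Space d × Space d → ℂ) (I : ℂ) : Prop :=
  ∀ χ : 𝓢(Space d × Space d, ℂ), χ 0 = 1 →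
    (∀ ε : ℝ, 0 < ε → Integrable (regularized χ F ε)) ∧
      Tendsto (fun ε : ℝ => ∫ p, regularized χ F ε p) (𝓝[>] 0) (𝓝 I)

/-- The oscillatory integral of `F` exists. -/
def OscIntegrable {d : ℕ} (F : Space d × Space d → ℂ) : Prop :=
  ∃ I : ℂ, HasOscIntegral F I

open Classical in
/-- The value `Os-∫∫ F(ξ, y) dy dξ` (by convention `0` if the oscillatory integral does not
exist). -/
def oscIntegral {d : ℕ} (F : Space d × Space d → ℂ) : ℂ :=
  if h : OscIntegrable F then h.choose else 0

theorem exists_cutoff (d : ℕ) : ∃ χ : 𝓢(Space d × Space d, ℂ), χ 0 = 1 := by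
  let b : ContDiffBump (0 : Space d × Space d) := ⟨1, 2, one_pos, one_lt_two⟩
  have hc : HasCompactSupport (fun p => ((b p : ℝ) : ℂ)) :=
    b.hasCompactSupport.comp_left (g := fun r : ℝ => (r : ℂ)) (by simp)
  have hs : ContDiff ℝ ∞ (fun p => ((b p : ℝ) : ℂ)) :=
    Complex.ofRealCLM.contDiff.comp b.contDiff
  refine ⟨hc.toSchwartzMap hs, ?_⟩
  have h1 : b 0 = 1 := b.one_of_mem_closedBall (by simp [b])
  change ((b 0 : ℝ) : ℂ) = 1
  simp [h1]

theorem HasOscIntegral.unique {d : ℕ} {F : Space d × Space d → ℂ} {I J : ℂ}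
    (hI : HasOscIntegral F I) (hJ : HasOscIntegral F J) : I = J := by
  obtain ⟨χ, hχ⟩ := exists_cutoff d
  exact tendsto_nhds_unique (hI χ hχ).2 (hJ χ hχ).2

theorem HasOscIntegral.oscIntegral_eq {d : ℕ} {F : Space d × Space d → ℂ} {I : ℂ}
    (hI : HasOscIntegral F I) : oscIntegral F = I := by
  have h : OscIntegrable F := ⟨I, hI⟩
  rw [oscIntegral, dif_pos h]
  exact h.choose_spec.unique hI

/-- The integrand `e^{i(x-y)·ξ} √((ξ - A((x+y)/2))² + m²) f(y)`. -/
def weylIntegrand {d : ℕ} (m : ℝ) (A : Space d → Space d) (f : Space d → ℂ) (x : Space d)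
    (p : Space d × Space d) : ℂ :=
  Complex.exp (Complex.I * ((inner ℝ (x - p.2) p.1 : ℝ) : ℂ)) *
    ((Real.sqrt (‖p.1 - A ((1 / 2 : ℝ) • (x + p.2))‖ ^ 2 + m ^ 2) : ℝ) : ℂ) * f p.2

/-- The integrand `e^{i(x-y)·(ξ + A((x+y)/2))} √(ξ² + m²) f(y)`. -/
def shiftedIntegrand {d : ℕ} (m : ℝ) (A : Space d → Space d) (f : Space d → ℂ) (x : Space d)
    (p : Space d × Space d) : ℂ :=
  Complex.exp (Complex.I * ((inner ℝ (x - p.2) (p.1 + A ((1 / 2 : ℝ) • (x + p.2))) : ℝ) : ℂ)) *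
    ((Real.sqrt (‖p.1‖ ^ 2 + m ^ 2) : ℝ) : ℂ) * f p.2

/-- The Weyl pseudo-differential operator `H_A^{(1)}` with mass `m` and vector potential `A`,
applied to `f` and evaluated at `x`. -/
def weylOperator {d : ℕ} (m : ℝ) (A : Space d → Space d) (f : Space d → ℂ) (x : Space d) : ℂ :=
  (1 / (2 * (Real.pi : ℂ)) ^ d) * oscIntegral (weylIntegrand m A f x)

end MagneticWeyl

end

noncomputable section

namespace MagneticWeyl

open scoped FourierTransform

/-! Write `B y = A ((x + y) / 2)`. The shear `(ξ, y) ↦ (ξ + B y, y)` preserves Lebesgue measure and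
carries the Weyl integrand to the shifted one. It also turns the cutoff into `χ (ε (ξ + B y), ε y)`,
which is no longer a rescaled Schwartz function, so the change of variables alone does not suffice.
The limit must be shown insensitive to such a shear of the cutoff.

That is `tendsto_integral_sheared_cutoff`. In the cutoff, `ξ` acts only as a translation, and on the
support of `f` the map `y ↦ (B y, y)` has bounded derivatives. Hence the `y`-derivatives of cutoff
times amplitude are bounded uniformly in `ξ` and `ε ≤ 1`. Integration by parts in `y` then makes the
inner integral decay faster than the growth of the symbol, uniformly in `ε`, and dominated
convergence applies. Both oscillatory integrals thus equal one absolutely convergent iterated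
integral. -/

/-! ### Uniform derivative bounds for cut-off amplitudes -/

theorem exists_norm_iteratedFDeriv_le_of_isCompact {V G : Type*}
    [NormedAddCommGroup V] [NormedSpace ℝ V] [NormedAddCommGroup G] [NormedSpace ℝ G]
    {u : V → G} (hu : ContDiff ℝ ∞ u) {K : Set V} (hK : IsCompact K) (n : ℕ) :
    ∃ D : ℝ, 1 ≤ D ∧ ∀ q ≤ n, ∀ y ∈ K, ‖iteratedFDeriv ℝ q u y‖ ≤ D := by
  have : ∀ q : ℕ, ∃ D, ∀ y ∈ K, ‖iteratedFDeriv ℝ q u y‖ ≤ D := fun q =>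
    hK.exists_bound_of_continuousOn
      (hu.continuous_iteratedFDeriv (m := q) (mod_cast le_top)).continuousOn
  choose D hD using this
  refine ⟨1 + ∑ q ∈ Finset.range (n + 1), |D q|, ?_, fun q hq y hy => ?_⟩
  · have : 0 ≤ ∑ q ∈ Finset.range (n + 1), |D q| := Finset.sum_nonneg fun _ _ => abs_nonneg _
    linarith
  · have := Finset.single_le_sum (f := fun q => |D q|) (fun _ _ => abs_nonneg _)
      (Finset.mem_range.2 (Nat.lt_succ_of_le hq))
    have h1 := hD q y hy
    have h2 := le_abs_self (D q)
    linarith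

/-- The derivatives up to order `n` of `y ↦ χ(a + ε h(y)) g(y)` are bounded uniformly in `a` and in
`ε ∈ [0, 1]`, if `χ` is a Schwartz function and `g` has compact support. -/
theorem exists_norm_iteratedFDeriv_schwartz_comp_mul_le {V W : Type*}
    [NormedAddCommGroup V] [NormedSpace ℝ V] [NormedAddCommGroup W] [NormedSpace ℝ W]
    (χ : 𝓢(W, ℂ)) {h : V → W} (hh : ContDiff ℝ ∞ h) {g : V → ℂ} (hg : ContDiff ℝ ∞ g)
    (hgc : HasCompactSupport g) (n : ℕ) :
    ∃ C : ℝ, ∀ (a : W) (ε : ℝ), 0 ≤ ε → ε ≤ 1 → ∀ q ≤ n, ∀ y,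
      ‖iteratedFDeriv ℝ q (fun y => χ (a + ε • h y) * g y) y‖ ≤
        (tsupport g).indicator (fun _ => C) y := by
  have hK : IsCompact (tsupport g) := hgc
  obtain ⟨D, hD1, hD⟩ := exists_norm_iteratedFDeriv_le_of_isCompact hh hK n
  obtain ⟨M, hM1, hM⟩ := exists_norm_iteratedFDeriv_le_of_isCompact hg hK n
  choose c hc0 hc using fun q => χ.decay 0 q
  simp only [pow_zero, one_mul] at hc
  set S : ℝ := ∑ q ∈ Finset.range (n + 1), c q with hS
  have hcS : ∀ q ≤ n, c q ≤ S := fun q hq =>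
    Finset.single_le_sum (f := c) (fun _ _ => (hc0 _).le) (Finset.mem_range.2 (Nat.lt_succ_of_le hq))
  have hS0 : 0 ≤ S := Finset.sum_nonneg fun _ _ => (hc0 _).le
  -- `2 ^ n` is the sum of the Leibniz coefficients; `n! * S * D ^ n` comes from the chain rule of
  -- higher order, and `M` bounds the derivatives of `g`.
  refine ⟨2 ^ n * (n.factorial * S * D ^ n * M), fun a ε hε0 hε1 q hq y => ?_⟩
  have hχ : ContDiff ℝ ∞ (fun z => χ (a + z)) := (χ.smooth ⊤).comp (contDiff_const.add contDiff_id)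
  have hεh : ContDiff ℝ ∞ (fun y => ε • h y) := hh.const_smul ε
  have hcomp : ContDiff ℝ ∞ (fun y => χ (a + ε • h y)) := hχ.comp hεh
  have hle := norm_iteratedFDeriv_mul_le (𝕜 := ℝ) (N := ∞) hcomp hg y (n := q) (mod_cast le_top)
  by_cases hy : y ∈ tsupport g
  · rw [Set.indicator_of_mem hy]
    refine hle.trans ?_
    have hterm : ∀ i ∈ Finset.range (q + 1),
        (q.choose i : ℝ) * ‖iteratedFDeriv ℝ i (fun y => χ (a + ε • h y)) y‖ *
          ‖iteratedFDeriv ℝ (q - i) g y‖ ≤ (q.choose i : ℝ) * (n.factorial * S * D ^ n * M) := by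
      intro i hi
      have hin : i ≤ n := (Nat.lt_succ_iff.1 (Finset.mem_range.1 hi)).trans hq
      have h1 : ‖iteratedFDeriv ℝ i ((fun z => χ (a + z)) ∘ fun y => ε • h y) y‖ ≤
          i.factorial * S * D ^ i := by
        refine norm_iteratedFDeriv_comp_le (N := ∞) hχ hεh (mod_cast le_top) y ?_ ?_
        · intro j hj
          -- The Schwartz bounds are translation invariant, whence uniformity in `a`.
          rw [iteratedFDeriv_comp_add_left]
          exact (hc _ _).trans (hcS j (hj.trans hin))
        · intro j hj1 hj
          rw [iteratedFDeriv_const_smul_apply' (hh.contDiffAt.of_le (mod_cast le_top)), norm_smul,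
            Real.norm_of_nonneg hε0]
          calc ε * ‖iteratedFDeriv ℝ j h y‖ ≤ 1 * D := by
                gcongr
                exact hD j (hj.trans hin) y hy
            _ = D := one_mul D
            _ ≤ D ^ j := le_self_pow₀ hD1 (by omega)
      have h2 : ‖iteratedFDeriv ℝ i (fun y => χ (a + ε • h y)) y‖ ≤ n.factorial * S * D ^ n := by
        refine h1.trans ?_
        gcongr
      rw [mul_assoc]
      gcongr
      exact hM _ (by omega) y hy
    refine (Finset.sum_le_sum hterm).trans ?_
    rw [← Finset.sum_mul]
    have : (∑ i ∈ Finset.range (q + 1), (q.choose i : ℝ)) = 2 ^ q := by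
      exact_mod_cast Nat.sum_range_choose q
    rw [this]
    gcongr
    norm_num
  · rw [Set.indicator_of_notMem hy]
    refine hle.trans (le_of_eq (Finset.sum_eq_zero fun i _ => ?_))
    have : iteratedFDeriv ℝ (q - i) g y = 0 := by
      by_contra hne
      exact hy (support_iteratedFDeriv_subset (𝕜 := ℝ) (q - i) hne)
    rw [this, norm_zero, mul_zero]

/-! ### Decay of the inner integral -/

theorem fourier_phase_eq {d : ℕ} (x ξ : Space d) (u : Space d → ℂ) :
    ∫ y, Complex.exp (Complex.I * ((inner ℝ (x - y) ξ : ℝ) : ℂ)) * u y =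
      Complex.exp (Complex.I * ((inner ℝ x ξ : ℝ) : ℂ)) * 𝓕 u ((2 * Real.pi)⁻¹ • ξ) := by
  rw [Real.fourier_eq', ← integral_const_mul]
  refine integral_congr_ae (Eventually.of_forall fun y => ?_)
  simp only [smul_eq_mul, ← mul_assoc, ← Complex.exp_add]
  congr 2
  rw [inner_sub_left, inner_smul_right]
  have : (Real.pi : ℂ) ≠ 0 := by exact_mod_cast Real.pi_ne_zero
  push_cast
  field_simp
  ring

/-- Decay of an oscillatory integral whose amplitude has `n` derivatives bounded on a compact set
outside which they vanish; the bound depends on nothing else. -/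
theorem exists_decay_phase_integral {d : ℕ} {K : Set (Space d)} (hK : IsCompact K) (C : ℝ) (n : ℕ) :
    ∃ M : ℝ, ∀ u : Space d → ℂ, ContDiff ℝ n u →
      (∀ q ≤ n, ∀ y, ‖iteratedFDeriv ℝ q u y‖ ≤ K.indicator (fun _ => C) y) →
      ∀ x ξ : Space d, (1 + ‖ξ‖) ^ n *
        ‖∫ y, Complex.exp (Complex.I * ((inner ℝ (x - y) ξ : ℝ) : ℂ)) * u y‖ ≤ M := by
  set V : ℝ := ∫ y, K.indicator (fun _ => C) y with hV
  have hind : Integrable (K.indicator (fun _ => C)) :=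
    (integrable_indicator_iff hK.measurableSet).2 (integrableOn_const hK.measure_lt_top.ne)
  -- `2 ^ (n - 1)` comes from splitting `(1 + ‖ξ‖) ^ n`, `(2π) ^ n` from the Fourier normalisation,
  -- and `2 ^ n * (n + 1)` from the Fourier bound by the `L¹` norms of `n + 1` derivatives.
  refine ⟨2 ^ (n - 1) * (V + (2 * Real.pi) ^ n * (2 ^ n * ((n + 1) * V))), fun u hu hb x ξ => ?_⟩
  have hint : ∀ q ≤ n, Integrable (fun y => ‖iteratedFDeriv ℝ q u y‖) := fun q hq =>
    hind.mono' (hu.continuous_iteratedFDeriv (m := q) (mod_cast hq)).norm.aestronglyMeasurable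
      (Eventually.of_forall fun y => by simpa using hb q hq y)
  have hintle : ∀ q ≤ n, ∫ y, ‖iteratedFDeriv ℝ q u y‖ ≤ V := fun q hq =>
    integral_mono (hint q hq) hind (hb q hq)
  have hnorm : ‖∫ y, Complex.exp (Complex.I * ((inner ℝ (x - y) ξ : ℝ) : ℂ)) * u y‖ =
      ‖𝓕 u ((2 * Real.pi)⁻¹ • ξ)‖ := by
    rw [fourier_phase_eq, norm_mul, mul_comm Complex.I, Complex.norm_exp_ofReal_mul_I, one_mul]
  rw [hnorm]
  set w := (2 * Real.pi)⁻¹ • ξ with hw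
  have h2π : (0 : ℝ) < 2 * Real.pi := by positivity
  have hξ : ‖ξ‖ = 2 * Real.pi * ‖w‖ := by
    rw [hw, norm_smul, Real.norm_of_nonneg (by positivity)]
    field_simp
  have hkey : ∀ q ≤ n, ‖w‖ ^ q * ‖𝓕 u w‖ ≤
      2 ^ q * ∑ p ∈ Finset.range (q + 1), ∫ y, ‖iteratedFDeriv ℝ p u y‖ := by
    intro q hq
    have := Real.pow_mul_norm_iteratedFDeriv_fourier_le (f := u) (K := 0) (N := n) hu
      (fun k j hk hj => by
        have hk0 : k = 0 := by simpa using hk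
        subst hk0
        simpa using hint j (by exact_mod_cast hj)) (k := 0) (n := q) le_rfl (mod_cast hq) w
    simpa [Finset.sum_product] using this
  have h0 : ‖𝓕 u w‖ ≤ V := by
    have := hkey 0 (Nat.zero_le _)
    simp only [pow_zero, one_mul, zero_add, Finset.sum_range_one] at this
    exact this.trans (hintle 0 (Nat.zero_le _))
  have h1 : ‖w‖ ^ n * ‖𝓕 u w‖ ≤ 2 ^ n * ((n + 1) * V) := by
    refine (hkey n le_rfl).trans ?_
    gcongr
    refine (Finset.sum_le_card_nsmul _ _ V fun q hq =>
      hintle q (Nat.lt_succ_iff.1 (Finset.mem_range.1 hq))).trans ?_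
    simp
  calc (1 + ‖ξ‖) ^ n * ‖𝓕 u w‖
      ≤ (2 ^ (n - 1) * (1 ^ n + ‖ξ‖ ^ n)) * ‖𝓕 u w‖ := by
        gcongr
        exact add_pow_le zero_le_one (norm_nonneg _) n
    _ = 2 ^ (n - 1) * (‖𝓕 u w‖ + (2 * Real.pi) ^ n * (‖w‖ ^ n * ‖𝓕 u w‖)) := by
        rw [hξ]; ring
    _ ≤ _ := by gcongr

/-! ### Integrability, the shear, and the two integrands -/

/-- A function of at most linear growth becomes integrable after multiplication by a rescaled
Schwartz function. -/
theorem integrable_regularized {d : ℕ} (χ : 𝓢(Space d × Space d, ℂ)) {F : Space d × Space d → ℂ}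
    (hF : Continuous F) {C : ℝ} (hC : ∀ p, ‖F p‖ ≤ C * (1 + ‖p‖)) {ε : ℝ} (hε : 0 < ε) :
    Integrable (regularized χ F ε) := by
  let e : (Space d × Space d) ≃L[ℝ] (Space d × Space d) :=
    ContinuousLinearEquiv.smulLeft (Units.mk0 ε hε.ne')
  let ψ : 𝓢(Space d × Space d, ℂ) := SchwartzMap.compCLMOfContinuousLinearEquiv ℝ e χ
  have hψ : ∀ p, ψ p = χ (ε • p) := fun p => rfl
  have : (volume : Measure (Space d × Space d)).IsAddHaarMeasure :=
    Measure.prod.instIsAddHaarMeasure _ _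
  have h0 := ψ.integrable_pow_mul volume 0
  have h1 := ψ.integrable_pow_mul volume 1
  refine ((h0.add h1).const_mul C).mono' ?_ (Eventually.of_forall fun p => ?_)
  · exact ((χ.continuous.comp (continuous_const_smul ε)).mul hF).aestronglyMeasurable
  · simp only [regularized, norm_mul, Pi.add_apply, hψ, pow_zero, pow_one, one_mul]
    calc ‖χ (ε • p)‖ * ‖F p‖ ≤ ‖χ (ε • p)‖ * (C * (1 + ‖p‖)) := by gcongr; exact hC p
      _ = _ := by ring

/-- For fixed `y` the map is a translation in `ξ`. Swapping the factors puts it in skew-product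
form. -/
theorem measurePreserving_shear {d : ℕ} {B : Space d → Space d} (hB : Continuous B) :
    MeasurePreserving (fun p : Space d × Space d => (p.1 + B p.2, p.2)) := by
  have h : MeasurePreserving (fun p : Space d × Space d => (p.1, p.2 + B p.1)) :=
    MeasurePreserving.skew_product (MeasurePreserving.id volume)
      (g := fun y ξ => ξ + B y) (by fun_prop)
      (Eventually.of_forall fun y => map_add_right_eq_self volume (B y))
  exact (Measure.measurePreserving_swap.comp h).comp Measure.measurePreserving_swap

theorem measurableEmbedding_shear {d : ℕ} {B : Space d → Space d} (hB : Continuous B) :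
    MeasurableEmbedding (fun p : Space d × Space d => (p.1 + B p.2, p.2)) := by
  let e : (Space d × Space d) ≃ₜ (Space d × Space d) :=
    { toFun := fun p => (p.1 + B p.2, p.2)
      invFun := fun p => (p.1 - B p.2, p.2)
      left_inv := fun p => by simp
      right_inv := fun p => by simp
      continuous_toFun := by fun_prop
      continuous_invFun := by fun_prop }
  exact e.measurableEmbedding

theorem norm_exp_I_mul_ofReal (t : ℝ) : ‖Complex.exp (Complex.I * (t : ℂ))‖ = 1 := by
  rw [mul_comm, Complex.norm_exp_ofReal_mul_I]

theorem sqrt_norm_sq_add_sq_le {E : Type*} [NormedAddCommGroup E] {m : ℝ} (hm : 0 ≤ m) (v : E) :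
    Real.sqrt (‖v‖ ^ 2 + m ^ 2) ≤ ‖v‖ + m := by
  rw [Real.sqrt_le_left (by positivity)]
  nlinarith [mul_nonneg (norm_nonneg v) hm]

/-- The amplitude `e^{i(x-y)·A((x+y)/2)} f(y)` of the shifted integrand. -/
def shiftedAmplitude {d : ℕ} (A : Space d → Space d) (f : Space d → ℂ) (x y : Space d) : ℂ :=
  Complex.exp (Complex.I * ((inner ℝ (x - y) (A ((1 / 2 : ℝ) • (x + y))) : ℝ) : ℂ)) * f y

theorem contDiff_midpoint {d : ℕ} {A : Space d → Space d} (hA : ContDiff ℝ ∞ A) (x : Space d) :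
    ContDiff ℝ ∞ (fun y => A ((1 / 2 : ℝ) • (x + y))) :=
  hA.comp ((contDiff_const.add contDiff_id).const_smul _)

theorem contDiff_shiftedAmplitude {d : ℕ} {A : Space d → Space d} (hA : ContDiff ℝ ∞ A)
    {f : Space d → ℂ} (hf : ContDiff ℝ ∞ f) (x : Space d) :
    ContDiff ℝ ∞ (shiftedAmplitude A f x) :=
  (Complex.contDiff_exp.comp (contDiff_const.mul (Complex.ofRealCLM.contDiff.comp
    ((contDiff_const.sub contDiff_id).inner ℝ (contDiff_midpoint hA x))))).mul hf

theorem hasCompactSupport_shiftedAmplitude {d : ℕ} (A : Space d → Space d)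
    {f : Space d → ℂ} (hfc : HasCompactSupport f) (x : Space d) :
    HasCompactSupport (shiftedAmplitude A f x) :=
  hfc.mul_left

theorem shiftedIntegrand_eq {d : ℕ} (m : ℝ) (A : Space d → Space d) (f : Space d → ℂ) (x : Space d)
    (ξ y : Space d) :
    shiftedIntegrand m A f x (ξ, y) = ((Real.sqrt (‖ξ‖ ^ 2 + m ^ 2) : ℝ) : ℂ) *
      (Complex.exp (Complex.I * ((inner ℝ (x - y) ξ : ℝ) : ℂ)) * shiftedAmplitude A f x y) := by
  simp only [shiftedIntegrand, shiftedAmplitude, inner_add_right, Complex.ofReal_add, mul_add,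
    Complex.exp_add]
  ring

theorem weylIntegrand_shear {d : ℕ} (m : ℝ) (A : Space d → Space d) (f : Space d → ℂ) (x : Space d)
    (p : Space d × Space d) :
    weylIntegrand m A f x (p.1 + A ((1 / 2 : ℝ) • (x + p.2)), p.2) = shiftedIntegrand m A f x p := by
  simp [weylIntegrand, shiftedIntegrand]

/-- A phase times the symbol `√(|ξ - B(y)|² + m²)` times a compactly supported amplitude grows at
most linearly. -/
theorem exists_norm_le_linear {d : ℕ} {m : ℝ} (hm : 0 ≤ m) {B : Space d → Space d}
    (hB : Continuous B) {f : Space d → ℂ} (hf : Continuous f) (hfc : HasCompactSupport f)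
    (θ : Space d × Space d → ℝ) :
    ∃ C : ℝ, ∀ p : Space d × Space d,
      ‖Complex.exp (Complex.I * (θ p : ℂ)) *
        ((Real.sqrt (‖p.1 - B p.2‖ ^ 2 + m ^ 2) : ℝ) : ℂ) * f p.2‖ ≤ C * (1 + ‖p‖) := by
  obtain ⟨C₁, h₁⟩ := hfc.exists_bound_of_continuous hf
  -- The growth of `B` is absorbed by the compact support of `f`.
  obtain ⟨C₂, h₂⟩ := (hfc.smul_left (f := fun y => ‖B y‖ + m)).exists_bound_of_continuous
    ((hB.norm.add continuous_const).smul hf)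
  refine ⟨C₁ + C₂, fun p => ?_⟩
  have hC₁ : 0 ≤ C₁ := (norm_nonneg _).trans (h₁ 0)
  have hC₂ : 0 ≤ C₂ := (norm_nonneg _).trans (h₂ 0)
  rw [norm_mul, norm_mul, norm_exp_I_mul_ofReal, one_mul, Complex.norm_real,
    Real.norm_of_nonneg (Real.sqrt_nonneg _)]
  have h₃ : (‖B p.2‖ + m) * ‖f p.2‖ ≤ C₂ := by
    have := h₂ p.2
    rwa [Pi.smul_apply', norm_smul, Real.norm_of_nonneg (by positivity)] at this
  have hp : ‖p.1‖ ≤ ‖p‖ := norm_fst_le p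
  calc Real.sqrt (‖p.1 - B p.2‖ ^ 2 + m ^ 2) * ‖f p.2‖
      ≤ (‖p.1‖ + ‖B p.2‖ + m) * ‖f p.2‖ := by
        gcongr
        exact (sqrt_norm_sq_add_sq_le hm _).trans (by gcongr; exact norm_sub_le _ _)
    _ = ‖p.1‖ * ‖f p.2‖ + (‖B p.2‖ + m) * ‖f p.2‖ := by ring
    _ ≤ ‖p‖ * C₁ + C₂ := by
        gcongr
        exact h₁ _
    _ ≤ (C₁ + C₂) * (1 + ‖p‖) := by nlinarith [norm_nonneg p, mul_nonneg hC₂ (norm_nonneg p)]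

theorem integrable_regularized_weylIntegrand {d : ℕ} {m : ℝ} (hm : 0 ≤ m) {A : Space d → Space d}
    (hA : Continuous A) {f : Space d → ℂ} (hf : Continuous f) (hfc : HasCompactSupport f)
    (x : Space d) (χ : 𝓢(Space d × Space d, ℂ)) {ε : ℝ} (hε : 0 < ε) :
    Integrable (regularized χ (weylIntegrand m A f x) ε) := by
  obtain ⟨C, hC⟩ := exists_norm_le_linear hm (B := fun y => A ((1 / 2 : ℝ) • (x + y)))
    (by fun_prop) hf hfc (fun p => inner ℝ (x - p.2) p.1)
  exact integrable_regularized χ (by fun_prop) hC hε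

theorem integrable_regularized_shiftedIntegrand {d : ℕ} {m : ℝ} (hm : 0 ≤ m)
    {A : Space d → Space d} (hA : Continuous A) {f : Space d → ℂ} (hf : Continuous f)
    (hfc : HasCompactSupport f) (x : Space d) (χ : 𝓢(Space d × Space d, ℂ)) {ε : ℝ} (hε : 0 < ε) :
    Integrable (regularized χ (shiftedIntegrand m A f x) ε) := by
  obtain ⟨C, hC⟩ := exists_norm_le_linear hm (B := fun _ => (0 : Space d)) continuous_const hf hfc
    (fun p => inner ℝ (x - p.2) (p.1 + A ((1 / 2 : ℝ) • (x + p.2))))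
  simp only [sub_zero] at hC
  exact integrable_regularized χ (by fun_prop) hC hε

/-! ### The limit and its independence of the shear -/

/-- Convergence of the regularized integrals, with a cutoff function that may be sheared. -/
theorem tendsto_integral_sheared_cutoff {d : ℕ} {m : ℝ} (hm : 0 ≤ m)
    {g : Space d → ℂ} (hg : ContDiff ℝ ∞ g) (hgc : HasCompactSupport g) (x : Space d)
    (χ : 𝓢(Space d × Space d, ℂ)) (hχ : χ 0 = 1) {B : Space d → Space d} (hB : ContDiff ℝ ∞ B)
    (hint : ∀ ε : ℝ, 0 < ε → Integrable (fun p : Space d × Space d =>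
      χ (ε • (p.1 + B p.2, p.2)) * (((Real.sqrt (‖p.1‖ ^ 2 + m ^ 2) : ℝ) : ℂ) *
        (Complex.exp (Complex.I * ((inner ℝ (x - p.2) p.1 : ℝ) : ℂ)) * g p.2)))) :
    Tendsto (fun ε : ℝ => ∫ p : Space d × Space d,
      χ (ε • (p.1 + B p.2, p.2)) * (((Real.sqrt (‖p.1‖ ^ 2 + m ^ 2) : ℝ) : ℂ) *
        (Complex.exp (Complex.I * ((inner ℝ (x - p.2) p.1 : ℝ) : ℂ)) * g p.2))) (𝓝[>] 0)
      (𝓝 (∫ ξ : Space d, ((Real.sqrt (‖ξ‖ ^ 2 + m ^ 2) : ℝ) : ℂ) *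
        ∫ y, Complex.exp (Complex.I * ((inner ℝ (x - y) ξ : ℝ) : ℂ)) * g y)) := by
  have hg0 : Continuous g := hg.continuous
  have hB0 : Continuous B := hB.continuous
  have hχ0 : Continuous χ := χ.continuous
  -- One power offsets the linear growth of the symbol; the other `d + 1` make the majorant
  -- integrable on `ℝ^d`.
  set N : ℕ := d + 2 with hN
  have hinner : ∀ (ε : ℝ) (ξ : Space d), ∫ y, χ (ε • (ξ + B y, y)) *
      (((Real.sqrt (‖ξ‖ ^ 2 + m ^ 2) : ℝ) : ℂ) *
        (Complex.exp (Complex.I * ((inner ℝ (x - y) ξ : ℝ) : ℂ)) * g y)) =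
      ((Real.sqrt (‖ξ‖ ^ 2 + m ^ 2) : ℝ) : ℂ) *
        ∫ y, Complex.exp (Complex.I * ((inner ℝ (x - y) ξ : ℝ) : ℂ)) *
          (χ (ε • (ξ + B y, y)) * g y) := by
    intro ε ξ
    rw [← integral_const_mul]
    congr 1 with y
    ring
  have hprod : ∀ ε : ℝ, 0 < ε → ∫ p : Space d × Space d,
      χ (ε • (p.1 + B p.2, p.2)) * (((Real.sqrt (‖p.1‖ ^ 2 + m ^ 2) : ℝ) : ℂ) *
        (Complex.exp (Complex.I * ((inner ℝ (x - p.2) p.1 : ℝ) : ℂ)) * g p.2)) =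
      ∫ ξ : Space d, ((Real.sqrt (‖ξ‖ ^ 2 + m ^ 2) : ℝ) : ℂ) *
        ∫ y, Complex.exp (Complex.I * ((inner ℝ (x - y) ξ : ℝ) : ℂ)) *
          (χ (ε • (ξ + B y, y)) * g y) := by
    intro ε hε
    have := integral_prod _ (hint ε hε)
    simp only [hinner] at this
    exact this
  have hev : ∀ᶠ ε : ℝ in 𝓝[>] 0, 0 < ε ∧ ε ≤ 1 := by
    filter_upwards [Ioc_mem_nhdsGT (zero_lt_one (α := ℝ))] with ε hε using hε
  refine Tendsto.congr' (hev.mono fun ε hε => (hprod ε hε.1).symm) ?_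
  obtain ⟨C, hC⟩ := exists_norm_iteratedFDeriv_schwartz_comp_mul_le χ
    (h := fun y => (B y, y)) (hB.prodMk contDiff_id) hg hgc N
  obtain ⟨M, hM⟩ := exists_decay_phase_integral (K := tsupport g) hgc C N
  -- Isolates `ξ` as the translation `a = (ε ξ, 0)`, over which the bound `hC` is uniform.
  have hcut : ∀ (ε : ℝ) (ξ y : Space d), ε • (ξ + B y, y) = (ε • ξ, 0) + ε • (B y, y) := by
    intro ε ξ y
    simp [smul_add]
  refine tendsto_integral_filter_of_dominated_convergence
    (fun ξ => (1 + m) * M * (1 + ‖ξ‖) ^ (-((d : ℝ) + 1))) ?_ ?_ ?_ ?_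
  · filter_upwards [hev] with ε hε
    have := (hint ε hε.1).integral_prod_left
    simp only [hinner] at this
    exact this.aestronglyMeasurable
  · filter_upwards [hev] with ε hε
    refine Eventually.of_forall fun ξ => ?_
    have hu : ContDiff ℝ N (fun y => χ (ε • (ξ + B y, y)) * g y) :=
      (((χ.smooth ⊤).comp (((contDiff_const.add hB).prodMk contDiff_id).const_smul ε)).mul
        hg).of_le (mod_cast le_top)
    have h1 := hM _ hu (by
      simp only [hcut]
      exact hC (ε • ξ, 0) ε hε.1.le hε.2) x ξ
    rw [norm_mul, Complex.norm_real, Real.norm_of_nonneg (Real.sqrt_nonneg _)]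
    set J := ‖∫ y, Complex.exp (Complex.I * ((inner ℝ (x - y) ξ : ℝ) : ℂ)) *
          (χ (ε • (ξ + B y, y)) * g y)‖
    have hpos : 0 < 1 + ‖ξ‖ := by positivity
    have h2 : Real.sqrt (‖ξ‖ ^ 2 + m ^ 2) ≤ (1 + m) * (1 + ‖ξ‖) :=
      (sqrt_norm_sq_add_sq_le hm ξ).trans (by nlinarith [norm_nonneg ξ, mul_nonneg hm (norm_nonneg ξ)])
    have h3 : (1 + ‖ξ‖) ^ (-((d : ℝ) + 1)) = ((1 + ‖ξ‖) ^ (d + 1))⁻¹ := by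
      rw [Real.rpow_neg hpos.le, ← Real.rpow_natCast]
      push_cast
      rfl
    rw [h3, ← div_eq_mul_inv, le_div_iff₀ (by positivity)]
    calc Real.sqrt (‖ξ‖ ^ 2 + m ^ 2) * J * (1 + ‖ξ‖) ^ (d + 1)
        ≤ ((1 + m) * (1 + ‖ξ‖)) * J * (1 + ‖ξ‖) ^ (d + 1) := by gcongr
      _ = (1 + m) * ((1 + ‖ξ‖) ^ N * J) := by rw [hN]; ring
      _ ≤ (1 + m) * M := by gcongr
  · refine (integrable_one_add_norm ?_).const_mul _
    simp
  -- For fixed `ξ` a second dominated convergence, in `y`, with majorant `c * ‖g y‖`, replaces the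
  -- cutoff by `χ 0 = 1`.
  · refine Eventually.of_forall fun ξ => Tendsto.const_mul _ ?_
    obtain ⟨c, hc0, hc⟩ := χ.decay 0 0
    simp only [pow_zero, one_mul, norm_iteratedFDeriv_zero] at hc
    refine tendsto_integral_filter_of_dominated_convergence (fun y => c * ‖g y‖) ?_ ?_ ?_ ?_
    · refine Eventually.of_forall fun ε => Continuous.aestronglyMeasurable ?_
      fun_prop
    · refine Eventually.of_forall fun ε => Eventually.of_forall fun y => ?_
      rw [norm_mul, norm_exp_I_mul_ofReal, one_mul, norm_mul]
      gcongr
      exact hc _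
    · exact (hg0.integrable_of_hasCompactSupport hgc).norm.const_mul c
    · refine Eventually.of_forall fun y => Tendsto.const_mul _ ?_
      have h1 : Tendsto (fun ε : ℝ => χ (ε • (ξ + B y, y)) * g y) (𝓝 0)
          (𝓝 (χ ((0 : ℝ) • (ξ + B y, y)) * g y)) :=
        Continuous.tendsto (by fun_prop) 0
      rw [zero_smul, hχ, one_mul] at h1
      exact h1.mono_left nhdsWithin_le_nhds

theorem hasOscIntegral_shiftedIntegrand {d : ℕ} {m : ℝ} (hm : 0 ≤ m) {A : Space d → Space d}
    (hA : ContDiff ℝ ∞ A) {f : Space d → ℂ} (hf : ContDiff ℝ ∞ f) (hfc : HasCompactSupport f)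
    (x : Space d) :
    HasOscIntegral (shiftedIntegrand m A f x)
      (∫ ξ : Space d, ((Real.sqrt (‖ξ‖ ^ 2 + m ^ 2) : ℝ) : ℂ) *
        ∫ y, Complex.exp (Complex.I * ((inner ℝ (x - y) ξ : ℝ) : ℂ)) *
          shiftedAmplitude A f x y) := by
  intro χ hχ
  have hint := fun (ε : ℝ) (hε : 0 < ε) => integrable_regularized_shiftedIntegrand hm
    hA.continuous hf.continuous hfc x χ hε
  refine ⟨hint, ?_⟩
  have key : ∀ ε p, regularized χ (shiftedIntegrand m A f x) ε p =
      χ (ε • (p.1 + 0, p.2)) * (((Real.sqrt (‖p.1‖ ^ 2 + m ^ 2) : ℝ) : ℂ) *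
        (Complex.exp (Complex.I * ((inner ℝ (x - p.2) p.1 : ℝ) : ℂ)) *
          shiftedAmplitude A f x p.2)) := by
    intro ε p
    rw [regularized, ← shiftedIntegrand_eq, add_zero]
  have := tendsto_integral_sheared_cutoff hm (contDiff_shiftedAmplitude hA hf x)
    (hasCompactSupport_shiftedAmplitude A hfc x) x χ hχ (B := fun _ => 0) contDiff_const
    (fun ε hε => (hint ε hε).congr (Eventually.of_forall (key ε)))
  simpa only [key] using this

theorem hasOscIntegral_weylIntegrand {d : ℕ} {m : ℝ} (hm : 0 ≤ m) {A : Space d → Space d}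
    (hA : ContDiff ℝ ∞ A) {f : Space d → ℂ} (hf : ContDiff ℝ ∞ f) (hfc : HasCompactSupport f)
    (x : Space d) :
    HasOscIntegral (weylIntegrand m A f x)
      (∫ ξ : Space d, ((Real.sqrt (‖ξ‖ ^ 2 + m ^ 2) : ℝ) : ℂ) *
        ∫ y, Complex.exp (Complex.I * ((inner ℝ (x - y) ξ : ℝ) : ℂ)) *
          shiftedAmplitude A f x y) := by
  intro χ hχ
  have hint := fun (ε : ℝ) (hε : 0 < ε) => integrable_regularized_weylIntegrand hm
    hA.continuous hf.continuous hfc x χ hε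
  refine ⟨hint, ?_⟩
  set B : Space d → Space d := fun y => A ((1 / 2 : ℝ) • (x + y)) with hB
  have hBs : ContDiff ℝ ∞ B := contDiff_midpoint hA x
  have hmp := measurePreserving_shear hBs.continuous
  have hme := measurableEmbedding_shear hBs.continuous
  have key : ∀ ε (p : Space d × Space d),
      regularized χ (weylIntegrand m A f x) ε (p.1 + B p.2, p.2) =
      χ (ε • (p.1 + B p.2, p.2)) * (((Real.sqrt (‖p.1‖ ^ 2 + m ^ 2) : ℝ) : ℂ) *
        (Complex.exp (Complex.I * ((inner ℝ (x - p.2) p.1 : ℝ) : ℂ)) *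
          shiftedAmplitude A f x p.2)) := by
    intro ε p
    rw [regularized, ← shiftedIntegrand_eq, hB, weylIntegrand_shear]
  -- The limit does not involve the shear `B`, so it is the value already found for the shifted
  -- integrand, where the shear is zero.
  have := tendsto_integral_sheared_cutoff hm (contDiff_shiftedAmplitude hA hf x)
    (hasCompactSupport_shiftedAmplitude A hfc x) x χ hχ hBs
    (fun ε hε => ((hmp.integrable_comp_emb hme).2 (hint ε hε)).congr
      (Eventually.of_forall (key ε)))
  simp only [← key] at this
  exact this.congr fun ε => hmp.integral_comp hme _

end MagneticWeyl

end

theorem proposition2p1 {d : ℕ} (m : ℝ) (hm : 0 ≤ m)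
    (A : MagneticWeyl.Space d → MagneticWeyl.Space d) (hA : ContDiff ℝ ∞ A)
    (τ : ℝ) (hτ : 0 ≤ τ)
    (hAτ : ∀ (n : ℕ) (i : Fin n → Fin d), ∃ C : ℝ, ∀ x : MagneticWeyl.Space d,
      ‖MagneticWeyl.partialDeriv i A x‖ ≤ C * (Real.sqrt (1 + ‖x‖ ^ 2)) ^ τ)
    (f : MagneticWeyl.Space d → ℂ) (hf : ContDiff ℝ ∞ f) (hfc : HasCompactSupport f)
    (x : MagneticWeyl.Space d) :
    MagneticWeyl.OscIntegrable (MagneticWeyl.weylIntegrand m A f x) ∧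
    MagneticWeyl.OscIntegrable (MagneticWeyl.shiftedIntegrand m A f x) ∧
    MagneticWeyl.weylOperator m A f x =
      (1 / (2 * (Real.pi : ℂ)) ^ d) *
        MagneticWeyl.oscIntegral (MagneticWeyl.shiftedIntegrand m A f x) := by
  have hw := MagneticWeyl.hasOscIntegral_weylIntegrand hm hA hf hfc x
  have hs := MagneticWeyl.hasOscIntegral_shiftedIntegrand hm hA hf hfc x
  refine ⟨⟨_, hw⟩, ⟨_, hs⟩, ?_⟩
  rw [MagneticWeyl.weylOperator, hw.oscIntegral_eq, hs.oscIntegral_eq]
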